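/- Write $[k]=\{1,\dots,k\}$, $\log=\log_2$, and let $d_{\rm TV}(\mathbf p,\mathbf q)=\sup_{S\subseteq[k]}(\mathbf p(S)-\mathbf q(S))$ be the total variation distance of probability distributions on $[k]$. A channel $W\colon[k]\to\mathcal Y$ assigns to every $x\in[k]$ a probability distribution $W(\cdot\mid x)$ on a measurable space $\mathcal Y$. A channel family $\mathcal W$ consists of a set $\mathcal W_k$ of channels $[k]\to\mathcal Y$ for every domain size $k$; it is assumed to be closed under compression of the input: if $m\le k$, $W\in\mathcal W_m$ and $f\colon[k]\to[m]$, then $W\circ f\in\mathcal W_k$ (as holds, e.g., for the channels with $\ell$-bit output and for the $\varrho$-locally differentially private channels). In an $s$-coin protocol with $n$ users on $[k]$ using $\mathcal W$, users $1,\dots,n$ hold independent samples $X_1,\dots,X_n$ from an unknown distribution $\mathbf p$ on $[k]$; $U$ is uniform on $\{0,1\}^s$, and $U_1,\dots,U_n$ are random variables such that $U,U_1,\dots,U_n,X_1,\dots,X_n$ are independent. User $i$ selects, as a (measurable) function of $U$ and $U_i$ only, a channel $W_i\in\mathcal W_k$ and sends the message $Y_i\sim W_i(\cdot\mid X_i)$,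 and the server outputs accept or reject by a (possibly randomized) test based on $U$ and $Y_1,\dots,Y_n$. A private-coin protocol is a $0$-coin protocol. We say that there is a $(k,\varepsilon,\delta)$-identity testing $s$-coin protocol using $\mathcal W$ with $n$ players if for every reference distribution $\mathbf q$ on $[k]$ there is an $s$-coin protocol with $n$ users on $[k]$ using $\mathcal W$ that accepts with probability $>1-\delta$ if $\mathbf p=\mathbf q$ and rejects with probability $>1-\delta$ if $d_{\rm TV}(\mathbf p,\mathbf q)>\varepsilon$. **Theorem.** There are absolute constants $s_0,c_0,c,c'>0$ and, for every $\delta\in(0,1)$, a positive integer $C=C(\delta)$ such that the following holds for every channel family $\mathcal W$ closed under compression of the input, every $\varepsilon\in(0,1)$, and all integers $k$ and $s$ with $s_0<s\le\log k-c_0$. Put $m=\lceil ck/2^s\rceil$ and $\varepsilon'=c'\varepsilon/2^{s/2}$. If there is an $(m,\varepsilon',1/12)$-identity testing private-coin protocol using $\mathcal W$ with $n=n(m,\varepsilon')$ players, then there is a $(k,\varepsilon,\delta)$-identity testing $s$-coin protocol using $\mathcal W$ with $C\cdot n$ players. In particular, if private-coin protocols using $\mathcal W$ with $n(\cdot,\cdot)$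 players are available for all parameters, then $C\cdot n(\lceil ck/2^s\rceil,\,c'\varepsilon/2^{s/2})$ players suffice for $(k,\varepsilon,\delta)$-identity testing with $s$ public coins. -/

import Mathlib

open MeasureTheory ProbabilityTheory
open scoped BigOperators

noncomputable section

namespace DistributedTesting

/-- Total variation distance between two distributions on `[k]`:
the supremum over events `S` of `p(S) - q(S)`. -/
def tvDist {k : ℕ} (p q : PMF (Fin k)) : ℝ :=
  ⨆ S : Set (Fin k), (p.toMeasure.real S - q.toMeasure.real S)

/-- A (randomized) channel with input alphabet `[k]` and output space `Y`: to every input `x`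
it assigns the law `W(· | x)` of the message. -/
abbrev Channel (k : ℕ) (Y : Type*) [MeasurableSpace Y] : Type _ :=
  Fin k → ProbabilityMeasure Y

/-- A channel family, given by the allowed channels `𝒲 k` for every domain size `k`, is closed
under compression of the input if mapping the sample from `[k]` to a domain `[m]` with `m ≤ k` and
then using an allowed channel with input alphabet `[m]` is an allowed channel on `[k]`. -/
def ClosedUnderCompression {Y : Type*} [MeasurableSpace Y]
    (𝒲 : (k : ℕ) → Set (Channel k Y)) : Prop :=
  ∀ (m k : ℕ), m ≤ k → ∀ f : Fin k → Fin m, ∀ W ∈ 𝒲 m, (fun x => W (f x)) ∈ 𝒲 k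

/-- An `s`-coin simultaneous-message-passing protocol with `n` users, for samples in `[k]`, using
channels from `𝒲`. User `i` holds a private random variable with values in `Ω i` and law `μ i`.
Given the public coins `u ∈ {0,1}^s` and the value `ω` of the private one, user `i` selects the
channel `channel i u ω ∈ 𝒲`. The server sees the public coins and all the messages, but not the
private randomness of the users, and outputs one bit by a (possibly randomized) test. -/
structure SMPProtocol {k : ℕ} {Y : Type*} [MeasurableSpace Y]
    (𝒲 : Set (Channel k Y)) (s n : ℕ) where
  Ω : Fin n → Type
  measurableSpaceΩ : ∀ i, MeasurableSpace (Ω i)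
  μ : ∀ i, Measure (Ω i)
  isProbabilityMeasure : ∀ i, IsProbabilityMeasure (μ i)
  channel : (i : Fin n) → (Fin s → Bool) → Ω i → Channel k Y
  channel_mem : ∀ i u ω, channel i u ω ∈ 𝒲
  measurable_channel : ∀ i u x, Measurable fun ω => (channel i u ω x : Measure Y)
  server : (Fin s → Bool) → Kernel (Fin n → Y) Bool
  isMarkovKernel_server : ∀ u, IsMarkovKernel (server u)

namespace SMPProtocol

attribute [instance] measurableSpaceΩ isProbabilityMeasure isMarkovKernel_server

variable {k : ℕ} {Y : Type*} [MeasurableSpace Y] {𝒲 : Set (Channel k Y)} {s n : ℕ}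

/-- The law of the message of user `i`, given the public coins `u`, when the samples have
distribution `p`: draw the private randomness `ω` of the user, draw the sample `x` from `p`,
and send it through the selected channel. -/
def messageLaw (P : SMPProtocol 𝒲 s n) (p : PMF (Fin k)) (u : Fin s → Bool) (i : Fin n) :
    Measure Y :=
  (P.μ i).bind fun ω => p.toMeasure.bind fun x => (P.channel i u ω x : Measure Y)

/-- The law of the bit output by the server given the public coins `u`. As the samples and the
private random variables are jointly independent, so are the messages. -/
def outputLaw (P : SMPProtocol 𝒲 s n) (p : PMF (Fin k)) (u : Fin s → Bool) : Measure Bool :=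
  (Measure.pi (P.messageLaw p u)).bind (P.server u)

/-- The probability that the protocol outputs `b` when the users hold `n` independent samples
from `p`; the public coins are uniform on `{0,1}^s`. -/
def outputProb (P : SMPProtocol 𝒲 s n) (p : PMF (Fin k)) (b : Bool) : ℝ :=
  (∑ u : Fin s → Bool, (P.outputLaw p u).real {b}) / 2 ^ s

/-- The protocol tests identity to `q` with distance parameter `ε` and error probability `δ`:
it outputs `false` (accept) with probability more than `1 - δ` if the samples come from `q`, and
`true` (reject) with probability more than `1 - δ` if they come from a distribution at total
variation distance more than `ε` from `q`. -/
def TestsIdentity (P : SMPProtocol 𝒲 s n) (q : PMF (Fin k)) (ε δ : ℝ) : Prop :=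
  1 - δ < P.outputProb q false ∧
    ∀ p : PMF (Fin k), ε < tvDist p q → 1 - δ < P.outputProb p true

end SMPProtocol

/-- There is a `(k, ε, δ)`-identity testing `s`-coin protocol using `𝒲` with `n` users: for every
reference distribution `q`, known to the users and to the server, some `s`-coin protocol with `n`
users tests identity to `q`. -/
def HasSCoinTest {k : ℕ} {Y : Type*} [MeasurableSpace Y] (𝒲 : Set (Channel k Y))
    (s n : ℕ) (ε δ : ℝ) : Prop :=
  ∀ q : PMF (Fin k), ∃ P : SMPProtocol 𝒲 s n, P.TestsIdentity q ε δ

/-- A private-coin protocol is one with no public coins. -/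
def HasPrivateCoinTest {k : ℕ} {Y : Type*} [MeasurableSpace Y] (𝒲 : Set (Channel k Y))
    (n : ℕ) (ε δ : ℝ) : Prop :=
  HasSCoinTest 𝒲 0 n ε δ

end DistributedTesting

end

/-! The public coins serve to compress the domain. Cut `[k]` into blocks of length `N = 2^s` and
merge each block into two points according to a sign vector in `{±1}^N`, the same for all blocks. If
`x = p - q`, merging keeps at least the sum over blocks of `|⟨a, x_b⟩|` of the `ℓ¹` norm. For a
typical sign vector this is of order `‖x‖₁ / √N`, so the distance shrinks by a factor of order
`2^(s/2)`.

The coins can index only `N` choices, and these must serve all real vectors at once. One random sign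
vector fails with constant probability; a list of `R` of them fails with probability exponentially
small in `R`. Among `N` random lists, the event that more than `N / h` fail for a given vector then
has probability small enough for a union bound over exponentially many (in `N`) vectors: the integer
points of an `ℓ¹` ball of radius `O(N)` (`exists_signs_forall_lattice`). A real vector is scaled and
rounded to such a point, each coordinate rounded so that the errors in the inner products do not add
up coherently; the errors are then harmless for most lists (`exists_signs_forall_real`). As `R`
depends only on `h`, it does not grow with `k` or `s`.

Markov's inequality over the blocks gives `exists_domain_compression`: for most outcomes of the
coins, one of `R` maps preserves the distance well enough. The protocol runs `T` private-coin tests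
for each map, and rejects if for some map the rejection probabilities given the messages average at
least one half. Chebyshev's inequality and a union bound over the `R` maps give error `δ`
(`combine_testsIdentity`). -/

namespace DistributedTesting

/-! ### Moments and lower tails of random signed sums. -/

/-- The sign `±1` encoded by a bit. -/
noncomputable def boolSign (b : Bool) : ℝ := if b then 1 else -1

/-- The inner product of a vector with the sign vector encoded by `a`. -/
noncomputable def signDot {ι : Type*} [Fintype ι] (a : ι → Bool) (z : ι → ℝ) : ℝ :=
  ∑ i, boolSign (a i) * z i

lemma abs_boolSign (b : Bool) : |boolSign b| = 1 := by cases b <;> simp [boolSign]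

lemma signDot_add {ι : Type*} [Fintype ι] (a : ι → Bool) (y z : ι → ℝ) :
    signDot a (fun i => y i + z i) = signDot a y + signDot a z := by
  simp [signDot, mul_add, Finset.sum_add_distrib]

lemma signDot_const_mul {ι : Type*} [Fintype ι] (a : ι → Bool) (r : ℝ) (z : ι → ℝ) :
    signDot a (fun i => r * z i) = r * signDot a z := by
  simp only [signDot, Finset.mul_sum]
  exact Finset.sum_congr rfl fun i _ => by ring

lemma signDot_cons {d : ℕ} (b : Bool) (a : Fin d → Bool) (z : Fin (d + 1) → ℝ) :
    signDot (Fin.cons b a : Fin (d + 1) → Bool) z =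
      boolSign b * z 0 + signDot a (fun i => z i.succ) := by
  simp [signDot, Fin.sum_univ_succ]

lemma sum_bool_vector_succ {d : ℕ} (F : (Fin (d + 1) → Bool) → ℝ) :
    ∑ a, F a = ∑ a : Fin d → Bool, (F (Fin.cons true a) + F (Fin.cons false a)) := by
  rw [← (Fin.consEquiv fun _ : Fin (d + 1) => Bool).sum_comp, Fintype.sum_prod_type,
    Fintype.sum_bool, ← Finset.sum_add_distrib]
  rfl

lemma sum_signDot_sq {d : ℕ} (z : Fin d → ℝ) :
    ∑ a, signDot a z ^ 2 = 2 ^ d * ∑ i, z i ^ 2 := by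
  induction d with
  | zero => simp [signDot]
  | succ d ih =>
    rw [sum_bool_vector_succ, Fin.sum_univ_succ]
    have h : ∀ a : Fin d → Bool, signDot (Fin.cons true a : Fin (d + 1) → Bool) z ^ 2 +
        signDot (Fin.cons false a : Fin (d + 1) → Bool) z ^ 2 =
        2 * z 0 ^ 2 + 2 * signDot a (fun i => z i.succ) ^ 2 := by
      intro a
      simp only [signDot_cons, boolSign]
      norm_num
      ring
    simp only [h, Finset.sum_add_distrib, ← Finset.mul_sum, ih]
    simp
    ring

/-- Averaging over the first sign kills the odd powers, and the remaining cross term is exactly that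
of the square on the right. -/
lemma sum_signDot_pow_four_le {d : ℕ} (z : Fin d → ℝ) :
    ∑ a, signDot a z ^ 4 ≤ 3 * 2 ^ d * (∑ i, z i ^ 2) ^ 2 := by
  induction d with
  | zero => simp [signDot]
  | succ d ih =>
    rw [sum_bool_vector_succ, Fin.sum_univ_succ]
    have h : ∀ a : Fin d → Bool, signDot (Fin.cons true a : Fin (d + 1) → Bool) z ^ 4 +
        signDot (Fin.cons false a : Fin (d + 1) → Bool) z ^ 4 =
        2 * signDot a (fun i => z i.succ) ^ 4 +
          12 * z 0 ^ 2 * signDot a (fun i => z i.succ) ^ 2 + 2 * z 0 ^ 4 := by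
      intro a
      simp only [signDot_cons, boolSign]
      norm_num
      ring
    simp only [h, Finset.sum_add_distrib, ← Finset.mul_sum, sum_signDot_sq]
    have := ih (fun i => z i.succ)
    have h4 : 0 ≤ (2 : ℝ) ^ d * z 0 ^ 4 := by positivity
    simp
    rw [pow_succ (2 : ℝ) d]
    nlinarith

lemma exp_neg_le_quadratic {y : ℝ} (hy : 0 ≤ y) : Real.exp (-y) ≤ 1 - y + y ^ 2 / 2 := by
  have h1 : 1 + y + y ^ 2 / 2 ≤ Real.exp y := by
    have := Real.quadratic_le_exp_of_nonneg hy
    linarith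
  rw [Real.exp_neg, inv_le_comm₀ (Real.exp_pos _) (by nlinarith [sq_nonneg (y - 1)])]
  refine le_trans ?_ h1
  rw [inv_le_iff_one_le_mul₀ (by nlinarith [sq_nonneg (y - 1)])]
  -- The product of `1 - y + y²/2` and `1 + y + y²/2` is `1 + y⁴/4`.
  nlinarith [pow_nonneg hy 4]

/-- Turns the second and fourth moments into a lower bound on the first absolute moment: `E t² = 1`
and `E t⁴ ≤ 3` give `E|t| ≥ 1/2`. -/
lemma sq_sub_pow_four_le_abs (t : ℝ) : t ^ 2 - t ^ 4 / 6 ≤ |t| := by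
  have h : ∀ τ : ℝ, 0 ≤ τ → τ ^ 2 - τ ^ 4 / 6 ≤ τ := by
    intro τ h0
    have : 0 ≤ 1 - τ + τ ^ 3 / 6 := by
      -- `7/5` approximates the minimiser `√2` of the cubic.
      nlinarith [mul_nonneg h0 (sq_nonneg (τ - 7/5)), sq_nonneg (τ - 7/5)]
    nlinarith
  have := h |t| (abs_nonneg t)
  rwa [sq_abs, show |t| ^ 4 = t ^ 4 by rw [show (4:ℕ) = 2 * 2 by rfl, pow_mul, sq_abs, ← pow_mul]]
    at this

/-- A random signed sum is not concentrated near zero: a bound on its Laplace transform. -/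
lemma sum_exp_neg_abs_signDot_le {d : ℕ} (z : Fin d → ℝ) (hz : 0 < ∑ i, z i ^ 2) :
    ∑ a, Real.exp (-(|signDot a z| / (2 * √(∑ i, z i ^ 2)))) ≤ 2 ^ d * (7 / 8) := by
  set v := ∑ i, z i ^ 2 with hv
  have hσ : 0 < √v := Real.sqrt_pos.2 hz
  have hσ2 : √v ^ 2 = v := Real.sq_sqrt hz.le
  have hσ4 : √v ^ 4 = v ^ 2 := by
    rw [show (4 : ℕ) = 2 * 2 by rfl, pow_mul, hσ2]
  -- With `t` the normalised signed sum, `E exp(-|t|/2) ≤ 1 - E|t|/2 + E t²/8 ≤ 1 - 1/4 + 1/8 =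
  -- 7/8`.
  have key : ∀ a : Fin d → Bool, Real.exp (-(|signDot a z| / (2 * √v))) ≤
      1 - (signDot a z ^ 2 / v - signDot a z ^ 4 / v ^ 2 / 6) / 2 + signDot a z ^ 2 / v / 8 := by
    intro a
    have h1 := exp_neg_le_quadratic (y := |signDot a z| / (2 * √v)) (by positivity)
    have h2 := sq_sub_pow_four_le_abs (signDot a z / √v)
    rw [div_pow, div_pow, hσ2, hσ4, abs_div, abs_of_pos hσ] at h2
    have h3 : |signDot a z| / (2 * √v) = (|signDot a z| / √v) / 2 := by field_simp
    have h4 : (|signDot a z| / (2 * √v)) ^ 2 / 2 = signDot a z ^ 2 / v / 8 := by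
      rw [div_pow, mul_pow, hσ2, sq_abs]; field_simp; norm_num
    rw [h4, h3] at h1
    rw [h3]
    linarith
  refine (Finset.sum_le_sum fun a _ => key a).trans ?_
  have e2 : ∑ a, signDot a z ^ 2 / v = 2 ^ d := by
    rw [← Finset.sum_div, sum_signDot_sq, mul_div_assoc, div_self hz.ne', mul_one]
  have e4 : ∑ a, signDot a z ^ 4 / v ^ 2 ≤ 3 * 2 ^ d := by
    rw [← Finset.sum_div, div_le_iff₀ (by positivity)]
    exact sum_signDot_pow_four_le z
  simp only [Finset.sum_add_distrib, Finset.sum_sub_distrib, ← Finset.sum_div, e2] at e4 ⊢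
  simp
  linarith

open Classical in
/-- Lower tail of a sum of `R` independent absolute values of random signed sums. -/
lemma card_sum_abs_signDot_lt_le {d R : ℕ} (z : Fin d → ℝ) :
    ((Finset.univ.filter fun a : Fin R → Fin d → Bool =>
        ∑ j, |signDot (a j) z| < R * √(∑ i, z i ^ 2) / 8).card : ℝ) ≤
      Fintype.card (Fin R → Fin d → Bool) * (14 / 15) ^ R := by
  rcases (Finset.sum_nonneg fun i (_ : i ∈ Finset.univ) => sq_nonneg (z i)).eq_or_lt with hz | hz
  · rw [← hz, Finset.filter_false_of_mem]
    · simp; positivity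
    · intro a _
      simp only [Real.sqrt_zero, mul_zero, zero_div, not_lt]
      positivity
  set σ := √(∑ i, z i ^ 2) with hσ'
  have hσ : 0 < σ := Real.sqrt_pos.2 hz
  set w : (Fin R → Fin d → Bool) → ℝ := fun a => ∏ j, Real.exp (-(|signDot (a j) z| / (2 * σ)))
  have hw : ∀ a ∈ Finset.univ.filter fun a : Fin R → Fin d → Bool =>
      ∑ j, |signDot (a j) z| < R * σ / 8, Real.exp (-(1 / 16)) ^ R ≤ w a := by
    intro a ha
    simp only [Finset.mem_filter, Finset.mem_univ, true_and] at ha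
    simp only [w]
    rw [← Real.exp_sum, ← Real.exp_nat_mul, Finset.sum_neg_distrib, ← Finset.sum_div]
    apply Real.exp_le_exp.2
    have : (∑ j, |signDot (a j) z|) / (2 * σ) ≤ R / 16 := by
      rw [div_le_iff₀ (by positivity)]
      linarith
    linarith
  have h1 := Finset.card_nsmul_le_sum _ _ _ hw
  have h2 : ∑ a, w a ≤ (2 ^ d * (7 / 8)) ^ R := by
    have := (Finset.prod_univ_sum (ι := Fin R) (fun _ => (Finset.univ : Finset (Fin d → Bool)))
      (fun _ b => Real.exp (-(|signDot b z| / (2 * σ)))))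
    simp only [Fintype.piFinset_univ, Finset.prod_const, Finset.card_univ, Fintype.card_fin] at this
    rw [← this]
    exact pow_le_pow_left₀ (by positivity) (sum_exp_neg_abs_signDot_le z hz) _
  have h3 : ∑ a ∈ Finset.univ.filter (fun a : Fin R → Fin d → Bool =>
      ∑ j, |signDot (a j) z| < R * σ / 8), w a ≤ ∑ a, w a :=
    Finset.sum_le_sum_of_subset_of_nonneg (Finset.filter_subset _ _) fun a _ _ =>
      Finset.prod_nonneg fun j _ => (Real.exp_pos _).le
  -- Exponential Markov: the ratio per factor is at most `(7/8) / (15/16) = 14/15`.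
  have h4 : (15 / 16 : ℝ) ≤ Real.exp (-(1 / 16)) := by
    have := Real.add_one_le_exp (-(1 / 16 : ℝ))
    linarith
  have h5 : (15 / 16 : ℝ) ^ R ≤ Real.exp (-(1 / 16)) ^ R := pow_le_pow_left₀ (by norm_num) h4 _
  rw [nsmul_eq_mul] at h1
  set c : ℝ := ((Finset.univ.filter fun a : Fin R → Fin d → Bool =>
        ∑ j, |signDot (a j) z| < R * σ / 8).card : ℝ)
  have h6 : c * (15 / 16) ^ R ≤ (2 ^ d * (7 / 8)) ^ R :=
    ((mul_le_mul_of_nonneg_left h5 (Nat.cast_nonneg _)).trans h1).trans (h3.trans h2)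
  rw [← le_div_iff₀ (by positivity), ← div_pow] at h6
  refine h6.trans (le_of_eq ?_)
  simp only [Fintype.card_fun, Fintype.card_bool, Fintype.card_fin]
  push_cast
  rw [← mul_pow]
  congr 1
  ring

/-! ### Union bound, and counting of integer points. -/

open Classical in
/-- Union bound over `Z` for `N` independent points of `Ω`, each of which is bad for a given
`z` with small probability. -/
lemma exists_forall_card_bad_le {Ω ζ : Type*} [Fintype Ω] [Nonempty Ω] (Z : Finset ζ)
    (bad : ζ → Ω → Prop) {N h : ℕ} {β K ℓ : ℝ} (hN : 0 < N) (hℓ1 : 1 ≤ ℓ) (hK0 : 0 ≤ K)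
    (hℓ : 2 * K < ℓ) (hβ : β * ℓ ^ h ≤ 1) (hZ : (Z.card : ℝ) ≤ K ^ N)
    (hbad : ∀ z ∈ Z, ((Finset.univ.filter (bad z)).card : ℝ) ≤ Fintype.card Ω * β) :
    ∃ A : Fin N → Ω, ∀ z ∈ Z, h * (Finset.univ.filter fun u => bad z (A u)).card ≤ N := by
  by_contra! hcon
  set T : ℝ := (Fintype.card Ω : ℝ) with hT
  have hT0 : 0 < T := by simp only [hT]; exact_mod_cast Fintype.card_pos
  have hℓ0 : 0 < ℓ := by linarith
  set E : ζ → Finset (Fin N → Ω) := fun z => Finset.univ.filter fun A =>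
    N < h * (Finset.univ.filter fun u => bad z (A u)).card with hE
  have hEz : ∀ z ∈ Z, ((E z).card : ℝ) * ℓ ^ N ≤ (T * 2) ^ N := by
    intro z hz
    -- Exponential Markov: on `E z` the product of the weights is at least `ℓ ^ N`, while each
    -- weight averages at most `1 + β * ℓ ^ h ≤ 2`. So `E z` has density at most `(2 / ℓ) ^ N`,
    -- which beats `K ^ N` choices of `z`.
    set w : Ω → ℝ := fun ω => 1 + (if bad z ω then ℓ ^ h else 0)
    have h1 : ∀ A ∈ E z, ℓ ^ N ≤ ∏ u, w (A u) := by
      intro A hA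
      simp only [hE, Finset.mem_filter, Finset.mem_univ, true_and] at hA
      calc ℓ ^ N ≤ ℓ ^ (h * (Finset.univ.filter fun u => bad z (A u)).card) :=
            pow_le_pow_right₀ hℓ1 hA.le
        _ = ∏ u ∈ Finset.univ.filter (fun u => bad z (A u)), ℓ ^ h := by
            rw [Finset.prod_const, pow_mul]
        _ = ∏ u, (if bad z (A u) then ℓ ^ h else 1) := by rw [Finset.prod_filter]
        _ ≤ ∏ u, w (A u) := by
            refine Finset.prod_le_prod (fun u _ => by split_ifs <;> positivity) fun u _ => ?_
            simp only [w]
            split_ifs <;> linarith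
    have h2 := Finset.card_nsmul_le_sum _ _ _ h1
    rw [nsmul_eq_mul] at h2
    refine h2.trans ((Finset.sum_le_sum_of_subset_of_nonneg (Finset.filter_subset _ _)
      fun A _ _ => Finset.prod_nonneg fun u _ => ?_).trans ?_)
    · simp only [w]; split_ifs <;> positivity
    · have := (Finset.prod_univ_sum (ι := Fin N) (fun _ => (Finset.univ : Finset Ω))
        (fun _ b => w b))
      simp only [Fintype.piFinset_univ, Finset.prod_const, Finset.card_univ,
        Fintype.card_fin] at this
      rw [← this]
      refine pow_le_pow_left₀ (Finset.sum_nonneg fun ω _ => ?_) ?_ _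
      · simp only [w]; split_ifs <;> positivity
      · simp only [w, Finset.sum_add_distrib, ← Finset.sum_filter, Finset.sum_const, nsmul_eq_mul]
        have h3 := mul_le_mul_of_nonneg_right (hbad z hz) (pow_pos hℓ0 h).le
        rw [mul_assoc] at h3
        have h4 := mul_le_mul_of_nonneg_left hβ hT0.le
        simp only [Finset.card_univ]
        linarith
  have hcover : (Finset.univ : Finset (Fin N → Ω)) ⊆ Z.biUnion E := by
    intro A _
    obtain ⟨z, hz, hlt⟩ := hcon A
    exact Finset.mem_biUnion.2 ⟨z, hz, by simpa [hE] using hlt⟩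
  have hcard : T ^ N ≤ ∑ z ∈ Z, ((E z).card : ℝ) := by
    have := (Finset.card_le_card hcover).trans Finset.card_biUnion_le
    rw [Finset.card_univ, Fintype.card_fun, Fintype.card_fin] at this
    simp only [hT]
    exact_mod_cast this
  have h5 : T ^ N * ℓ ^ N ≤ K ^ N * (T * 2) ^ N := by
    calc T ^ N * ℓ ^ N ≤ (∑ z ∈ Z, ((E z).card : ℝ)) * ℓ ^ N := by gcongr
      _ = ∑ z ∈ Z, ((E z).card : ℝ) * ℓ ^ N := Finset.sum_mul _ _ _
      _ ≤ ∑ z ∈ Z, (T * 2) ^ N := Finset.sum_le_sum hEz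
      _ = Z.card * (T * 2) ^ N := by simp
      _ ≤ _ := by gcongr
  rw [← mul_pow, ← mul_pow] at h5
  have h6 : K * (T * 2) < T * ℓ := by nlinarith
  exact absurd h5 (not_le.2 (pow_lt_pow_left₀ h6 (by positivity) hN.ne'))

lemma sum_half_pow_natAbs_le (Q : ℕ) :
    ∑ n ∈ Finset.Icc (-(Q : ℤ)) Q, (1 / 2 : ℝ) ^ n.natAbs = 3 - 2 * (1 / 2) ^ Q := by
  induction Q with
  | zero => simp; norm_num
  | succ Q ih =>
    have h : Finset.Icc (-((Q + 1 : ℕ) : ℤ)) ((Q + 1 : ℕ) : ℤ) =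
        insert (-((Q + 1 : ℕ) : ℤ)) (insert ((Q + 1 : ℕ) : ℤ) (Finset.Icc (-(Q : ℤ)) Q)) := by
      ext n
      simp only [Finset.mem_Icc, Finset.mem_insert]
      omega
    rw [h, Finset.sum_insert, Finset.sum_insert, ih, Int.natAbs_neg, Int.natAbs_natCast, pow_succ]
    · ring
    · simp
    · simp only [Finset.mem_Icc, Finset.mem_insert]
      omega

/-- The integer points of the `ℓ¹` ball of radius `Q` in dimension `d`. -/
noncomputable def latticeBall (d Q : ℕ) : Finset (Fin d → ℤ) :=
  (Fintype.piFinset fun _ => Finset.Icc (-(Q : ℤ)) Q).filter fun z => ∑ i, (z i).natAbs ≤ Q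

lemma mem_latticeBall {d Q : ℕ} {z : Fin d → ℤ} :
    z ∈ latticeBall d Q ↔ ∑ i, (z i).natAbs ≤ Q := by
  simp only [latticeBall, Finset.mem_filter, Fintype.mem_piFinset, Finset.mem_Icc,
    and_iff_right_iff_imp]
  intro h i
  have := (Finset.single_le_sum (f := fun i => (z i).natAbs) (fun _ _ => Nat.zero_le _)
    (Finset.mem_univ i)).trans h
  omega

/-- Give `z` the weight `2^(-‖z‖₁)`, which is at least `2^(-Q)` on the ball; the total weight
factors over coordinates, each contributing less than `3`. -/
lemma card_latticeBall_le (d Q : ℕ) : ((latticeBall d Q).card : ℝ) ≤ 3 ^ d * 2 ^ Q := by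
  have h1 : ∀ z ∈ latticeBall d Q, (1 / 2 : ℝ) ^ Q ≤ ∏ i, (1 / 2 : ℝ) ^ (z i).natAbs := by
    intro z hz
    rw [Finset.prod_pow_eq_pow_sum]
    exact pow_le_pow_of_le_one (by norm_num) (by norm_num) (mem_latticeBall.1 hz)
  have h2 := Finset.card_nsmul_le_sum _ _ _ h1
  have h3 : ∑ z ∈ latticeBall d Q, ∏ i, (1 / 2 : ℝ) ^ (z i).natAbs ≤ 3 ^ d := by
    refine (Finset.sum_le_sum_of_subset_of_nonneg (Finset.filter_subset _ _)
      fun z _ _ => by positivity).trans ?_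
    rw [Finset.sum_prod_piFinset (Finset.Icc (-(Q : ℤ)) Q) fun _ n => (1 / 2 : ℝ) ^ n.natAbs,
      Finset.prod_const, Finset.card_univ, Fintype.card_fin, sum_half_pow_natAbs_le]
    have h4 : (1 / 2 : ℝ) ^ Q ≤ 1 := pow_le_one₀ (by norm_num) (by norm_num)
    exact pow_le_pow_left₀ (by linarith) (by linarith [show (0:ℝ) < (1 / 2) ^ Q by positivity]) _
  rw [nsmul_eq_mul] at h2
  have h5 := h2.trans h3
  rw [one_div, inv_pow, ← div_eq_mul_inv, div_le_iff₀ (by positivity)] at h5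
  exact h5

/-! ### Sign vectors that suit all real vectors. -/

/-- Rounding a real vector to an integer vector so that the inner products with given vectors of
sup norm at most one change little on average. -/
lemma exists_rounding {ρ : Type*} [Fintype ρ] {d : ℕ} (a : ρ → Fin d → ℝ)
    (ha : ∀ r i, |a r i| ≤ 1) (x : Fin d → ℝ) :
    ∃ z : Fin d → ℤ, (∀ i, |(z i : ℝ) - x i| ≤ 1) ∧
      ∑ r, (∑ i, a r i * (z i - x i)) ^ 2 ≤ Fintype.card ρ * d := by
  induction d with
  | zero => exact ⟨fun i => 0, fun i => i.elim0, by simp⟩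
  | succ d ih =>
    obtain ⟨z, hz1, hz2⟩ := ih (fun r i => a r i.succ) (fun r i => ha r i.succ) fun i => x i.succ
    set e : ρ → ℝ := fun r => ∑ i : Fin d, a r i.succ * (z i - x i.succ) with he
    -- Round the new coordinate up or down so that its error is not positively correlated with the
    -- accumulated errors `e`. The cross term drops, and each row's square grows by at most `1` on
    -- balance.
    obtain ⟨n, hn1, hn2⟩ : ∃ n : ℤ, |(n : ℝ) - x 0| ≤ 1 ∧
        ((n : ℝ) - x 0) * ∑ r, a r 0 * e r ≤ 0 := by
      have h1 := Int.floor_le (x 0)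
      have h2 := Int.lt_floor_add_one (x 0)
      rcases le_total 0 (∑ r, a r 0 * e r) with h | h
      · exact ⟨⌊x 0⌋, by rw [abs_le]; constructor <;> linarith,
          mul_nonpos_of_nonpos_of_nonneg (by linarith) h⟩
      · refine ⟨⌊x 0⌋ + 1, ?_, ?_⟩
        · push_cast; rw [abs_le]; constructor <;> linarith
        · push_cast; exact mul_nonpos_of_nonneg_of_nonpos (by linarith) h
    refine ⟨Fin.cons n z, Fin.cases (by simpa using hn1) (by simpa using hz1), ?_⟩
    have h3 : ∀ r, (∑ i, a r i * (((Fin.cons n z : Fin (d + 1) → ℤ) i : ℝ) - x i)) ^ 2 ≤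
        e r ^ 2 + 2 * ((n - x 0) * (a r 0 * e r)) + 1 := by
      intro r
      rw [Fin.sum_univ_succ]
      simp only [Fin.cons_zero, Fin.cons_succ]
      have h4 : (a r 0 * (n - x 0)) ^ 2 ≤ 1 := by
        rw [sq_le_one_iff_abs_le_one, abs_mul]
        exact mul_le_one₀ (ha r 0) (abs_nonneg _) hn1
      have h5 : ∑ i : Fin d, a r i.succ * ((z i : ℝ) - x i.succ) = e r := rfl
      rw [h5]
      nlinarith
    refine (Finset.sum_le_sum fun r _ => h3 r).trans ?_
    simp only [Finset.sum_add_distrib, ← Finset.mul_sum]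
    simp only [Finset.sum_const, Finset.card_univ, nsmul_eq_mul, mul_one]
    push_cast
    linarith

lemma sum_abs_le_sqrt_mul_sqrt {ι : Type*} (s : Finset ι) (f : ι → ℝ) :
    ∑ i ∈ s, |f i| ≤ √s.card * √(∑ i ∈ s, f i ^ 2) := by
  rw [← Real.sqrt_mul (Nat.cast_nonneg _)]
  apply Real.le_sqrt_of_sq_le
  have := sq_sum_le_card_mul_sum_sq (s := s) (f := fun i => |f i|)
  simpa only [sq_abs] using this

open Classical in
/-- An integer point is bad for few of the rows of sign vectors, if these are well chosen. -/
lemma exists_signs_forall_lattice {h : ℕ} (M : ℕ) : ∃ R : ℕ, 0 < R ∧ ∀ N : ℕ, 0 < N →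
    ∃ A : Fin N → Fin R → Fin N → Bool, ∀ z ∈ latticeBall N (M * N),
      h * (Finset.univ.filter fun u =>
        ∑ j, |signDot (A u j) (fun i => (z i : ℝ))| <
          R * √(∑ i, (z i : ℝ) ^ 2) / 8).card ≤ N := by
  set K : ℝ := 3 * 2 ^ M
  have hK : 0 < K := by positivity
  set ℓ : ℝ := 2 * K + 1
  have hℓ : 0 < ℓ ^ h := by positivity
  -- `R` is fixed before `N`: both the number of lattice points and the gain from `N` independent
  -- lists are exponential in `N`. Using `R + 1` below only ensures positivity.
  obtain ⟨R, hR⟩ := exists_pow_lt_of_lt_one (inv_pos.2 hℓ) (show (14 / 15 : ℝ) < 1 by norm_num)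
  refine ⟨R + 1, Nat.succ_pos _, fun N hN => ?_⟩
  have hβ : (14 / 15 : ℝ) ^ (R + 1) * ℓ ^ h ≤ 1 := by
    have h1 : (14 / 15 : ℝ) ^ R * ℓ ^ h ≤ 1 := by
      rw [← le_div_iff₀ hℓ, one_div]
      exact hR.le
    have h2 : 0 ≤ (14 / 15 : ℝ) ^ R * ℓ ^ h := by positivity
    rw [pow_succ]
    nlinarith
  have hZ : ((latticeBall N (M * N)).card : ℝ) ≤ K ^ N := by
    refine (card_latticeBall_le _ _).trans (le_of_eq ?_)
    rw [pow_mul, ← mul_pow]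
  obtain ⟨A, hA⟩ := exists_forall_card_bad_le (latticeBall N (M * N))
    (fun z (a : Fin (R + 1) → Fin N → Bool) => ∑ j, |signDot (a j) (fun i => (z i : ℝ))| <
      ((R + 1 : ℕ) : ℝ) * √(∑ i, (z i : ℝ) ^ 2) / 8) hN
    (by simp only [ℓ]; linarith) hK.le (by simp only [ℓ]; linarith) hβ hZ
    fun z _ => by convert card_sum_abs_signDot_lt_le (R := R + 1) fun i => (z i : ℝ)
  refine ⟨A, fun z hz => ?_⟩
  convert hA z hz

open Classical in
/-- Lists of sign vectors, such that every real vector has a large average inner product with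
the vectors of most of the lists. -/
lemma exists_signs_forall_real (h : ℕ) : ∃ R : ℕ, 0 < R ∧ ∀ N : ℕ, 0 < N →
    ∃ A : Fin N → Fin R → Fin N → Bool, ∀ x : Fin N → ℝ,
      h * (Finset.univ.filter fun u =>
        ∑ j, |signDot (A u j) x| < R / 16 * ((∑ i, |x i|) / √N)).card ≤ 2 * N := by
  -- Chosen so that `(M' - 1) / 8 - h = M' / 16`: main term from `‖z‖₂ ≥ (M' - 1)√N`, minus the
  -- rounding error `h√N`, equals the claimed bound for the scaled vector.
  set M' : ℕ := 2 + 16 * h with hM'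
  obtain ⟨R, hR, hA⟩ := exists_signs_forall_lattice (h := h) (M' + 1)
  refine ⟨R, hR, fun N hN => ?_⟩
  obtain ⟨A, hA⟩ := hA N hN
  refine ⟨A, fun x => ?_⟩
  have hN' : (0 : ℝ) < N := by exact_mod_cast hN
  have hR' : (0 : ℝ) < R := by exact_mod_cast hR
  have hsN : 0 < √(N : ℝ) := Real.sqrt_pos.2 hN'
  have hsN2 : √(N : ℝ) * √N = N := Real.mul_self_sqrt hN'.le
  rcases (Finset.sum_nonneg fun i (_ : i ∈ Finset.univ) => abs_nonneg (x i)).eq_or_lt with hx | hx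
  · rw [← hx, Finset.filter_false_of_mem]
    · simp
    · intro u _
      simp only [zero_div, mul_zero, not_lt]
      positivity
  set S := ∑ i, |x i| with hS
  set r : ℝ := M' * N / S with hr
  have hM'0 : (0 : ℝ) < M' := by simp only [hM']; positivity
  have hr0 : 0 < r := by positivity
  have hrS : r * S = M' * N := by simp only [hr]; field_simp
  obtain ⟨z, hz1, hz2⟩ := exists_rounding (fun (ui : Fin N × Fin R) i => boolSign (A ui.1 ui.2 i))
    (fun _ _ => (abs_boolSign _).le) fun i => r * x i
  set y : Fin N → ℝ := fun i => z i - r * x i with hy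
  have hzx : ∀ i, (z i : ℝ) = r * x i + y i := fun i => by simp only [hy]; ring
  have hysum : ∑ i, |y i| ≤ N := by
    refine (Finset.sum_le_sum fun i _ => hz1 i).trans ?_
    simp
  have hzsum : ∑ i, |(z i : ℝ)| ≤ M' * N + N := by
    calc ∑ i, |(z i : ℝ)| ≤ ∑ i, (r * |x i| + |y i|) := by
          refine Finset.sum_le_sum fun i _ => ?_
          rw [hzx i]
          refine (abs_add_le _ _).trans ?_
          rw [abs_mul, abs_of_pos hr0]
      _ = M' * N + ∑ i, |y i| := by rw [Finset.sum_add_distrib, ← Finset.mul_sum, hrS]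
      _ ≤ _ := by linarith
  have hzsum' : M' * N - N ≤ ∑ i, |(z i : ℝ)| := by
    have : M' * N ≤ ∑ i, (|(z i : ℝ)| + |y i|) := by
      rw [← hrS, hS, Finset.mul_sum]
      refine Finset.sum_le_sum fun i _ => ?_
      have h1 : r * |x i| = |(z i : ℝ) - y i| := by
        rw [hzx i, add_sub_cancel_right, abs_mul, abs_of_pos hr0]
      rw [h1]
      exact abs_sub _ _
    rw [Finset.sum_add_distrib] at this
    linarith
  have hmem : z ∈ latticeBall N ((M' + 1) * N) := by
    rw [mem_latticeBall]
    have : ((∑ i, (z i).natAbs : ℕ) : ℝ) ≤ (((M' + 1) * N : ℕ) : ℝ) := by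
      push_cast
      simp only [Nat.cast_natAbs, Int.cast_abs]
      linarith
    exact_mod_cast this
  have hbad1 := hA z hmem
  set F1 := Finset.univ.filter fun u => ∑ j, |signDot (A u j) (fun i => (z i : ℝ))| <
    R * √(∑ i, (z i : ℝ) ^ 2) / 8
  -- The lists on which the rounding error is large; few by Markov, since the squared errors total
  -- at most `N * R * N`.
  set F2 := Finset.univ.filter fun u => (R : ℝ) * (h * N) < ∑ j, signDot (A u j) y ^ 2 with hF2
  have hbad2 : h * F2.card ≤ N := by
    have h1 : ∑ u, ∑ j, signDot (A u j) y ^ 2 ≤ N * R * N := by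
      rw [← Fintype.sum_prod_type' fun u j => signDot (A u j) y ^ 2]
      simpa [signDot, hy] using hz2
    have h2 : F2.card • ((R : ℝ) * (h * N)) ≤ N * R * N := by
      refine (Finset.card_nsmul_le_sum F2 (fun u => ∑ j, signDot (A u j) y ^ 2) _ ?_).trans
        ((Finset.sum_le_sum_of_subset_of_nonneg (Finset.filter_subset _ _)
          fun u _ _ => Finset.sum_nonneg fun j _ => sq_nonneg _).trans h1)
      intro u hu
      simp only [hF2, Finset.mem_filter, Finset.mem_univ, true_and] at hu
      exact hu.le
    rw [nsmul_eq_mul] at h2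
    have h3 : (h * F2.card : ℝ) * (R * N) ≤ N * (R * N) := by linarith
    exact_mod_cast le_of_mul_le_mul_right h3 (by positivity)
  refine le_trans (Nat.mul_le_mul_left h (Finset.card_le_card (t := F1 ∪ F2) ?_)) ?_
  · intro u hu
    by_contra hcon
    simp only [F1, hF2, Finset.mem_union, Finset.mem_filter, Finset.mem_univ, true_and, not_or,
      not_lt] at hu hcon
    obtain ⟨hg1, hg2⟩ := hcon
    have h1 : ∑ j, |signDot (A u j) (fun i => (z i : ℝ))| ≤
        r * ∑ j, |signDot (A u j) x| + ∑ j, |signDot (A u j) y| := by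
      rw [Finset.mul_sum, ← Finset.sum_add_distrib]
      refine Finset.sum_le_sum fun j _ => ?_
      simp only [hzx]
      rw [signDot_add, signDot_const_mul]
      refine (abs_add_le _ _).trans ?_
      rw [abs_mul, abs_of_pos hr0]
    have h2 : ∑ j, |signDot (A u j) y| ≤ R * (√h * √N) := by
      refine (sum_abs_le_sqrt_mul_sqrt _ _).trans ?_
      rw [Finset.card_univ, Fintype.card_fin]
      calc √(R : ℝ) * √(∑ j, signDot (A u j) y ^ 2) ≤ √(R : ℝ) * √(R * (h * N)) := by gcongr
        _ = R * (√h * √N) := by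
          rw [Real.sqrt_mul hR'.le, ← mul_assoc, Real.mul_self_sqrt hR'.le,
            Real.sqrt_mul (Nat.cast_nonneg _)]
    have h3 : (M' - 1) * √(N : ℝ) ≤ √(∑ i, (z i : ℝ) ^ 2) := by
      have := (hzsum'.trans (sum_abs_le_sqrt_mul_sqrt Finset.univ fun i => (z i : ℝ)))
      rw [Finset.card_univ, Fintype.card_fin] at this
      refine le_of_mul_le_mul_left ?_ hsN
      nlinarith
    have h4 : √(h : ℝ) ≤ h := by
      rw [Real.sqrt_le_left (Nat.cast_nonneg _)]
      rcases Nat.eq_zero_or_pos h with h0 | h0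
      · simp [h0]
      · have : (1 : ℝ) ≤ h := by exact_mod_cast h0
        nlinarith
    have h5 : r * (R / 16 * (S / √N)) = R * (M' * √N) / 16 := by
      have : r * (R / 16 * (S / √N)) = R / 16 * (r * S) / √N := by ring
      rw [this, hrS, div_eq_iff hsN.ne']
      linear_combination -(R * M' / 16 : ℝ) * hsN2
    have h6 := mul_lt_mul_of_pos_left hu hr0
    rw [h5] at h6
    have h7 : (R : ℝ) * ((M' - 1) * √N) / 8 ≤ R * √(∑ i, (z i : ℝ) ^ 2) / 8 := by gcongr
    have h8 : (R : ℝ) * (√h * √N) ≤ R * (h * √N) := by gcongr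
    have h9 : (M' : ℝ) = 2 + 16 * h := by simp [hM']
    rw [h9] at h6 h7
    nlinarith
  · refine (Nat.mul_le_mul_left h (Finset.card_union_le _ _)).trans ?_
    linarith

open Classical in
/-- The version of the above for vectors that are divided into blocks of length `N`, with the
same signs in all the blocks. -/
lemma exists_signs_forall_blocks (h : ℕ) (hh : 0 < h) : ∃ R : ℕ, 0 < R ∧ ∀ N : ℕ, 0 < N →
    ∃ A : Fin N → Fin R → Fin N → Bool, ∀ (B : ℕ) (x : Fin B → Fin N → ℝ),
      h * (Finset.univ.filter fun u => ∀ j,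
        ∑ b, |signDot (A u j) (x b)| < 1 / 32 * ((∑ b, ∑ i, |x b i|) / √N)).card ≤ 4 * N := by
  obtain ⟨R, hR, hA⟩ := exists_signs_forall_real h
  refine ⟨R, hR, fun N hN => ?_⟩
  obtain ⟨A, hA⟩ := hA N hN
  refine ⟨A, fun B x => ?_⟩
  have hN' : (0 : ℝ) < N := by exact_mod_cast hN
  have hR' : (0 : ℝ) < R := by exact_mod_cast hR
  have hh' : (0 : ℝ) < h := by exact_mod_cast hh
  have hsN : 0 < √(N : ℝ) := Real.sqrt_pos.2 hN'
  set w : Fin B → ℝ := fun b => ∑ i, |x b i| with hw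
  have hw0 : ∀ b, 0 ≤ w b := fun b => Finset.sum_nonneg fun i _ => abs_nonneg _
  set S := ∑ b, w b with hS
  have hS0 : 0 ≤ S := Finset.sum_nonneg fun b _ => hw0 b
  set F := Finset.univ.filter fun u => ∀ j,
    ∑ b, |signDot (A u j) (x b)| < 1 / 32 * (S / √N) with hF
  rcases hS0.eq_or_lt with hS' | hS'
  · have : F = ∅ := by
      rw [hF, Finset.filter_false_of_mem]
      intro u _ hcon
      have := hcon ⟨0, hR⟩
      rw [← hS', zero_div, mul_zero] at this
      exact absurd this (not_lt.2 (by positivity))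
    simp [this]
  set bad : Fin N → Fin B → Prop := fun u b =>
    ∑ j, |signDot (A u j) (x b)| < R / 16 * (w b / √N) with hbad
  -- If all `R` signs fail, so does their average. Good blocks contribute at least `R / 16` times
  -- their weight over `√N`, so they carry at most half of the weight.
  have h1 : ∀ u ∈ F, S / 2 ≤ ∑ b, if bad u b then w b else 0 := by
    intro u hu
    simp only [hF, Finset.mem_filter, Finset.mem_univ, true_and] at hu
    have h2 : ∑ b, ∑ j, |signDot (A u j) (x b)| ≤ R * (1 / 32 * (S / √N)) := by
      rw [Finset.sum_comm]
      refine (Finset.sum_le_sum fun j _ => (hu j).le).trans ?_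
      simp
    have h3 : ∑ b, R / 16 * ((w b - if bad u b then w b else 0) / √N) ≤
        ∑ b, ∑ j, |signDot (A u j) (x b)| := by
      refine Finset.sum_le_sum fun b _ => ?_
      split_ifs with hb
      · simp; positivity
      · simpa [hbad] using hb
    have h4 : (R / 16 : ℝ) * ((S - ∑ b, if bad u b then w b else 0) / √N) ≤
        R / 16 * ((S / 2) / √N) := by
      rw [hS, ← Finset.sum_sub_distrib, Finset.sum_div, Finset.mul_sum, ← hS]
      refine (h3.trans h2).trans (le_of_eq ?_)
      ring
    have h5 := le_of_mul_le_mul_left h4 (by positivity)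
    rw [div_le_div_iff_of_pos_right hsN] at h5
    linarith
  have h2 := Finset.card_nsmul_le_sum _ _ _ h1
  -- Double counting: each block is bad for at most `2 * N / h` of the lists.
  have h3 : (∑ u ∈ F, ∑ b, if bad u b then w b else 0) ≤
      ∑ b, w b * ((Finset.univ.filter fun u => bad u b).card : ℝ) := by
    refine (Finset.sum_le_sum_of_subset_of_nonneg (Finset.filter_subset _ _) fun u _ _ =>
      Finset.sum_nonneg fun b _ => by split_ifs <;> simp [hw0]).trans ?_
    rw [Finset.sum_comm]
    refine Finset.sum_le_sum fun b _ => ?_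
    rw [← Finset.sum_filter, Finset.sum_const, nsmul_eq_mul, mul_comm]
  have h4 : ∀ b, ((Finset.univ.filter fun u => bad u b).card : ℝ) ≤ 2 * N / h := by
    intro b
    rw [le_div_iff₀ hh', mul_comm]
    exact_mod_cast hA (x b)
  have h5 : ∑ b, w b * ((Finset.univ.filter fun u => bad u b).card : ℝ) ≤ S * (2 * N / h) := by
    rw [hS, Finset.sum_mul]
    exact Finset.sum_le_sum fun b _ => mul_le_mul_of_nonneg_left (h4 b) (hw0 b)
  have h6 := h2.trans (h3.trans h5)
  rw [nsmul_eq_mul] at h6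
  have h7 : S * (h * F.card : ℝ) ≤ S * (4 * N) := by
    have := mul_le_mul_of_nonneg_left h6 (show (0 : ℝ) ≤ 2 * h by positivity)
    have e : 2 * (h : ℝ) * (S * (2 * N / h)) = S * (4 * N) := by field_simp; ring
    rw [e] at this
    linarith
  exact_mod_cast le_of_mul_le_mul_left h7 hS'

/-! ### Total variation distance and domain compression. -/

lemma pmf_toMeasure_real_eq_sum {k : ℕ} (p : PMF (Fin k)) (S : Set (Fin k)) :
    p.toMeasure.real S = ∑ x, S.indicator (fun x => (p x).toReal) x := by
  rw [measureReal_def, PMF.toMeasure_apply_fintype, ENNReal.toReal_sum]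
  · refine Finset.sum_congr rfl fun x _ => ?_
    by_cases hx : x ∈ S <;> simp [hx]
  · intro x _
    by_cases hx : x ∈ S <;> simp [hx, p.apply_ne_top]

lemma pmf_sum_toReal {k : ℕ} (p : PMF (Fin k)) : ∑ x, (p x).toReal = 1 := by
  have := pmf_toMeasure_real_eq_sum p Set.univ
  simpa using this.symm

lemma tvDist_le_half_sum_abs {k : ℕ} (p q : PMF (Fin k)) :
    tvDist p q ≤ (∑ x, |(p x).toReal - (q x).toReal|) / 2 := by
  refine ciSup_le fun S => ?_
  rw [pmf_toMeasure_real_eq_sum, pmf_toMeasure_real_eq_sum, ← Finset.sum_sub_distrib]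
  have h0 : ∑ x, ((p x).toReal - (q x).toReal) = 0 := by
    rw [Finset.sum_sub_distrib, pmf_sum_toReal, pmf_sum_toReal, sub_self]
  have h1 : 2 * ∑ x, (S.indicator (fun x => (p x).toReal) x -
      S.indicator (fun x => (q x).toReal) x) - ∑ x, ((p x).toReal - (q x).toReal) ≤
      ∑ x, |(p x).toReal - (q x).toReal| := by
    rw [Finset.mul_sum, ← Finset.sum_sub_distrib]
    refine Finset.sum_le_sum fun x _ => ?_
    have h2 := neg_abs_le ((p x).toReal - (q x).toReal)
    have h3 := le_abs_self ((p x).toReal - (q x).toReal)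
    by_cases hx : x ∈ S <;> simp only [hx, Set.indicator_of_mem, not_false_eq_true,
      Set.indicator_of_notMem] <;> linarith
  linarith

lemma half_sum_abs_le_tvDist {k : ℕ} (p q : PMF (Fin k)) :
    (∑ x, |(p x).toReal - (q x).toReal|) / 2 ≤ tvDist p q := by
  set S : Set (Fin k) := {x | (q x).toReal ≤ (p x).toReal} with hS
  refine le_trans ?_ (le_ciSup (Set.finite_range fun S : Set (Fin k) =>
    p.toMeasure.real S - q.toMeasure.real S).bddAbove S)
  rw [pmf_toMeasure_real_eq_sum, pmf_toMeasure_real_eq_sum, ← Finset.sum_sub_distrib]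
  have h0 : ∑ x, ((p x).toReal - (q x).toReal) = 0 := by
    rw [Finset.sum_sub_distrib, pmf_sum_toReal, pmf_sum_toReal, sub_self]
  have h1 : ∑ x, |(p x).toReal - (q x).toReal| ≤
      2 * ∑ x, (S.indicator (fun x => (p x).toReal) x -
      S.indicator (fun x => (q x).toReal) x) - ∑ x, ((p x).toReal - (q x).toReal) := by
    rw [Finset.mul_sum, ← Finset.sum_sub_distrib]
    refine Finset.sum_le_sum fun x _ => ?_
    by_cases hx : x ∈ S
    · simp only [hx, Set.indicator_of_mem]
      rw [abs_of_nonneg (sub_nonneg.2 hx)]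
      linarith
    · simp only [hx, not_false_eq_true, Set.indicator_of_notMem]
      have : (p x).toReal < (q x).toReal := by simpa [hS] using hx
      rw [abs_of_nonpos (by linarith)]
      linarith
  linarith

lemma pmf_map_toReal {k m : ℕ} (p : PMF (Fin k)) (f : Fin k → Fin m) (y : Fin m) :
    (p.map f y).toReal = ∑ t, if f t = y then (p t).toReal else 0 := by
  rw [PMF.map_apply, tsum_fintype, ENNReal.toReal_sum]
  · refine Finset.sum_congr rfl fun t _ => ?_
    simp only [eq_comm (a := y)]
    split_ifs <;> simp
  · intro t _
    split_ifs <;> simp [p.apply_ne_top]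

/-- Merging the elements of every block into two according to signs keeps at least the absolute
values of the signed sums over the blocks. -/
lemma sum_abs_signDot_le_sum_abs_fiber {k B N m : ℕ} (blk : Fin k → Fin B) (pos : Fin k → Fin N)
    (g : Fin B × Bool ↪ Fin m) (a : Fin N → Bool) (x : Fin k → ℝ) :
    ∑ b, |signDot a fun i => ∑ t, if (blk t, pos t) = (b, i) then x t else 0| ≤
      ∑ y, |∑ t, if g (blk t, a (pos t)) = y then x t else 0| := by
  have h1 : ∑ bc : Fin B × Bool, |∑ t, if g (blk t, a (pos t)) = g bc then x t else 0| ≤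
      ∑ y, |∑ t, if g (blk t, a (pos t)) = y then x t else 0| := by
    rw [← Finset.sum_map Finset.univ g
      fun y => |∑ t, if g (blk t, a (pos t)) = y then x t else 0|]
    exact Finset.sum_le_sum_of_subset_of_nonneg (Finset.subset_univ _) fun _ _ _ => abs_nonneg _
  refine le_trans ?_ h1
  rw [Fintype.sum_prod_type]
  refine Finset.sum_le_sum fun b _ => ?_
  rw [Fintype.sum_bool]
  -- The signed sum over a block is the difference of the masses of its two merged points.
  refine le_trans (le_of_eq ?_) (abs_sub _ _)
  congr 1
  simp only [signDot, g.injective.eq_iff, Finset.mul_sum]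
  rw [Finset.sum_comm, ← Finset.sum_sub_distrib]
  refine Finset.sum_congr rfl fun t _ => ?_
  rw [Finset.sum_eq_single (pos t)]
  · by_cases hb : blk t = b <;> cases h : a (pos t) <;> simp [hb, boolSign]
  · intro i _ hi
    simp [hi.symm]
  · simp

/-- Each (block, position) cell holds at most one element, so there is no cancellation; empty cells
of an incomplete block contribute zero. -/
lemma sum_abs_le_sum_abs_blocks {k B N : ℕ} (blk : Fin k → Fin B) (pos : Fin k → Fin N)
    (hinj : Function.Injective fun t => (blk t, pos t)) (x : Fin k → ℝ) :
    ∑ t, |x t| ≤ ∑ b, ∑ i, |∑ t, if (blk t, pos t) = (b, i) then x t else 0| := by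
  rw [← Fintype.sum_prod_type' fun b i => |∑ t, if (blk t, pos t) = (b, i) then x t else 0|]
  refine le_trans ?_ (Finset.sum_le_sum_of_subset_of_nonneg
    (Finset.subset_univ (Finset.univ.map ⟨_, hinj⟩)) fun _ _ _ => abs_nonneg _)
  rw [Finset.sum_map]
  refine Finset.sum_le_sum fun t _ => le_of_eq ?_
  have h : ∀ t', ((blk t', pos t') = (blk t, pos t)) ↔ t' = t := fun t' => hinj.eq_iff (a := t')
  simp [h]

open Classical in
/-- Domain compression with `s` public coins: a list of `R` maps for every outcome of the coins,
such that for most outcomes one of the maps roughly preserves the total variation distance. -/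
lemma exists_domain_compression (h : ℕ) (hh : 0 < h) : ∃ R : ℕ, 0 < R ∧
    ∀ s k B m : ℕ, k ≤ B * 2 ^ s → 2 * B ≤ m →
      ∃ f : (Fin s → Bool) → Fin R → Fin k → Fin m, ∀ p q : PMF (Fin k),
        h * (Finset.univ.filter fun u => ∀ j,
          tvDist (p.map (f u j)) (q.map (f u j)) < 1 / 32 * tvDist p q / √(2 ^ s)).card ≤
            4 * 2 ^ s := by
  obtain ⟨R, hR, hA⟩ := exists_signs_forall_blocks h hh
  refine ⟨R, hR, fun s k B m hk hm => ?_⟩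
  set N := 2 ^ s with hNdef
  have hN : 0 < N := by positivity
  obtain ⟨A, hA⟩ := hA N hN
  let e : (Fin s → Bool) ≃ Fin N := Fintype.equivFinOfCardEq (by simp [hNdef])
  let blk : Fin k → Fin B := fun t =>
    ⟨t / N, (Nat.div_lt_iff_lt_mul hN).2 (t.2.trans_le hk)⟩
  let pos : Fin k → Fin N := fun t => ⟨t % N, Nat.mod_lt _ hN⟩
  have hinj : Function.Injective fun t => (blk t, pos t) := by
    intro t t' htt
    simp only [Prod.mk.injEq, blk, pos, Fin.mk.injEq] at htt
    ext
    rw [← Nat.div_add_mod (t : ℕ) N, htt.1, htt.2, Nat.div_add_mod]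
  let g : Fin B × Bool ↪ Fin m :=
    ⟨fun bc => ⟨2 * bc.1 + bc.2.toNat, by
      have := bc.1.2
      have := Bool.toNat_le bc.2
      omega⟩, by
      rintro ⟨b, c⟩ ⟨b', c'⟩ hbc
      simp only [Fin.mk.injEq] at hbc
      cases c <;> cases c' <;> simp at hbc <;> simp <;> omega⟩
  refine ⟨fun u j t => g (blk t, A (e u) j (pos t)), fun p q => ?_⟩
  set x : Fin k → ℝ := fun t => (p t).toReal - (q t).toReal with hx
  have hA' := hA B fun b i => ∑ t, if (blk t, pos t) = (b, i) then x t else 0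
  refine le_trans (Nat.mul_le_mul_left h ?_) hA'
  refine Finset.card_le_card_of_injOn e ?_ e.injective.injOn
  intro u hu
  simp only [Finset.coe_filter, Finset.mem_univ, true_and, Set.mem_ofPred_eq] at hu ⊢
  intro j
  have h1 := hu j
  have h2 := half_sum_abs_le_tvDist (p.map fun t => g (blk t, A (e u) j (pos t)))
    (q.map fun t => g (blk t, A (e u) j (pos t)))
  have h3 := tvDist_le_half_sum_abs p q
  have h4 := sum_abs_signDot_le_sum_abs_fiber blk pos g (A (e u) j) x
  have h5 := sum_abs_le_sum_abs_blocks blk pos hinj x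
  have h6 : ∀ y, ((p.map fun t => g (blk t, A (e u) j (pos t))) y).toReal -
      ((q.map fun t => g (blk t, A (e u) j (pos t))) y).toReal =
      ∑ t, if g (blk t, A (e u) j (pos t)) = y then x t else 0 := by
    intro y
    rw [pmf_map_toReal, pmf_map_toReal, ← Finset.sum_sub_distrib]
    refine Finset.sum_congr rfl fun t _ => ?_
    split_ifs <;> simp [hx]
  simp only [h6] at h2
  have h7 : (0 : ℝ) < √N := Real.sqrt_pos.2 (by exact_mod_cast hN)
  have h8 : √((2 : ℝ) ^ s) = √N := by simp [hNdef]
  rw [h8, lt_div_iff₀ h7] at h1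
  rw [mul_div_assoc', lt_div_iff₀ h7]
  have h9 := mul_le_mul_of_nonneg_right (h4.trans (by linarith [h2])) h7.le
    (c := 2 * tvDist (p.map fun t => g (blk t, A (e u) j (pos t)))
      (q.map fun t => g (blk t, A (e u) j (pos t))))
  linarith

/-! ### Message laws, product measures and concentration. -/

lemma bind_map_eq_bind_comp {α β γ : Type*} [MeasurableSpace α] [MeasurableSpace β]
    [MeasurableSpace γ] (μ : Measure α) {g : α → β} (hg : Measurable g) {F : β → Measure γ}
    (hF : Measurable F) : (μ.map g).bind F = μ.bind (fun a => F (g a)) := by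
  rw [Measure.bind, Measure.bind, Measure.map_map hF hg]
  rfl

lemma pmf_bind_apply {k : ℕ} {Y : Type*} [MeasurableSpace Y] (p : PMF (Fin k))
    (V : Fin k → Measure Y) {S : Set Y} (hS : MeasurableSet S) :
    (p.toMeasure.bind V) S = ∑ x, V x S * p x := by
  rw [Measure.bind_apply hS Measurable.of_discrete.aemeasurable, lintegral_fintype]
  simp only [PMF.toMeasure_apply_singleton _ _ (measurableSet_singleton _)]

lemma measurable_pmf_bind {k : ℕ} {Y Ω : Type*} [MeasurableSpace Y] [MeasurableSpace Ω]
    (p : PMF (Fin k)) (V : Ω → Fin k → Measure Y) (hV : ∀ x, Measurable fun ω => V ω x) :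
    Measurable fun ω => p.toMeasure.bind (V ω) := by
  refine Measure.measurable_of_measurable_coe _ fun S hS => ?_
  simp only [pmf_bind_apply _ _ hS]
  exact Finset.measurable_sum _ fun x _ =>
    ((Measure.measurable_coe hS).comp (hV x)).mul_const _

lemma isProbabilityMeasure_bind {α β : Type*} [MeasurableSpace α] [MeasurableSpace β]
    (μ : Measure α) [IsProbabilityMeasure μ] {F : α → Measure β} (hF : Measurable F)
    (h : ∀ a, IsProbabilityMeasure (F a)) : IsProbabilityMeasure (μ.bind F) := by
  constructor
  rw [Measure.bind_apply MeasurableSet.univ hF.aemeasurable]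
  simp

namespace SMPProtocol

variable {k : ℕ} {Y : Type*} [MeasurableSpace Y] {𝒲 : Set (Channel k Y)} {s n : ℕ}

lemma measurable_messageLaw_aux (P : SMPProtocol 𝒲 s n) (p : PMF (Fin k)) (u : Fin s → Bool)
    (i : Fin n) :
    Measurable fun ω => p.toMeasure.bind fun x => (P.channel i u ω x : Measure Y) :=
  measurable_pmf_bind p (fun ω x => (P.channel i u ω x : Measure Y))
    fun x => P.measurable_channel i u x

instance isProbabilityMeasure_messageLaw (P : SMPProtocol 𝒲 s n) (p : PMF (Fin k))
    (u : Fin s → Bool) (i : Fin n) : IsProbabilityMeasure (P.messageLaw p u i) :=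
  isProbabilityMeasure_bind _ (P.measurable_messageLaw_aux p u i) fun _ =>
    isProbabilityMeasure_bind _ Measurable.of_discrete fun _ => inferInstance

instance isProbabilityMeasure_outputLaw (P : SMPProtocol 𝒲 s n) (p : PMF (Fin k))
    (u : Fin s → Bool) : IsProbabilityMeasure (P.outputLaw p u) :=
  isProbabilityMeasure_bind _ (P.server u).measurable fun _ => inferInstance

lemma outputLaw_real_false (P : SMPProtocol 𝒲 s n) (p : PMF (Fin k)) (u : Fin s → Bool) :
    (P.outputLaw p u).real {false} = 1 - (P.outputLaw p u).real {true} := by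
  rw [← probReal_compl_eq_one_sub (measurableSet_singleton _)]
  congr 1
  ext b
  cases b <;> simp

lemma outputProb_zero_coins (P : SMPProtocol 𝒲 0 n) (p : PMF (Fin k)) (b : Bool) :
    P.outputProb p b = (P.outputLaw p default).real {b} := by
  simp only [outputProb, Finset.univ_unique, Finset.sum_singleton, pow_zero, div_one]
  exact congrArg (fun u => (P.outputLaw p u).real {b}) (Subsingleton.elim _ _)

/-- The probability that the server rejects after receiving the given messages. -/
noncomputable def rejectProb (P : SMPProtocol 𝒲 s n) (u : Fin s → Bool) (y : Fin n → Y) : ℝ :=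
  (P.server u y).real {true}

lemma measurable_rejectProb (P : SMPProtocol 𝒲 s n) (u : Fin s → Bool) :
    Measurable (P.rejectProb u) :=
  (Kernel.measurable_coe _ (measurableSet_singleton _)).ennreal_toReal

lemma rejectProb_mem_Icc (P : SMPProtocol 𝒲 s n) (u : Fin s → Bool) (y : Fin n → Y) :
    P.rejectProb u y ∈ Set.Icc (0 : ℝ) 1 :=
  ⟨measureReal_nonneg, measureReal_le_one⟩

lemma integral_rejectProb (P : SMPProtocol 𝒲 s n) (p : PMF (Fin k)) (u : Fin s → Bool) :
    ∫ y, P.rejectProb u y ∂(Measure.pi (P.messageLaw p u)) = (P.outputLaw p u).real {true} := by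
  rw [outputLaw, measureReal_def, Measure.bind_apply (measurableSet_singleton _)
    (P.server u).measurable.aemeasurable]
  exact integral_toReal (Kernel.measurable_coe _ (measurableSet_singleton _)).aemeasurable
    (ae_of_all _ fun y => measure_lt_top _ _)

end SMPProtocol

/-- The law of a block of the coordinates under a product measure. -/
lemma map_comp_injective_pi {ι κ Y : Type*} [Fintype ι] [Fintype κ] [MeasurableSpace Y]
    (ν : ι → Measure Y) [∀ i, IsProbabilityMeasure (ν i)] {g : κ → ι}
    (hg : Function.Injective g) :
    (Measure.pi ν).map (fun y c => y (g c)) = Measure.pi fun c => ν (g c) := by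
  have h1 : iIndepFun (fun i (y : ι → Y) => y i) (Measure.pi ν) :=
    iIndepFun_pi (X := fun _ => id) fun _ => aemeasurable_id
  have h2 := (iIndepFun_iff_map_fun_eq_pi_map
    fun c => (measurable_pi_apply (g c)).aemeasurable).1 (h1.precomp hg)
  rw [h2]
  congr 1
  ext c : 1
  exact (measurePreserving_eval ν (g c)).map_eq

/-- Functions of disjoint blocks of the coordinates are independent under a product measure. -/
lemma indepFun_of_disjoint_blocks {ι κ Y : Type*} [Fintype ι] [MeasurableSpace Y]
    (ν : ι → Measure Y) [∀ i, IsProbabilityMeasure (ν i)] {g g' : κ → ι}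
    (hgg' : ∀ c c', g c ≠ g' c') {G G' : (κ → Y) → ℝ} (hG : Measurable G) (hG' : Measurable G') :
    IndepFun (fun y : ι → Y => G fun c => y (g c)) (fun y : ι → Y => G' fun c => y (g' c))
      (Measure.pi ν) := by
  classical
  have h1 : iIndepFun (fun i (y : ι → Y) => y i) (Measure.pi ν) :=
    iIndepFun_pi (X := fun _ => id) fun _ => aemeasurable_id
  set S := Finset.univ.filter fun i => ∃ c, g c = i with hS
  set S' := Finset.univ.filter fun i => ∃ c, g' c = i with hS'
  have hdisj : Disjoint S S' := by
    rw [Finset.disjoint_left]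
    intro i hi hi'
    simp only [hS, hS', Finset.mem_filter, Finset.mem_univ, true_and] at hi hi'
    obtain ⟨c, rfl⟩ := hi
    obtain ⟨c', hc'⟩ := hi'
    exact hgg' c c' hc'.symm
  have h2 := h1.indepFun_finset S S' hdisj fun i => measurable_pi_apply i
  have hφ : Measurable fun z : S → Y => G fun c => z ⟨g c, by simp [hS]⟩ :=
    hG.comp (measurable_pi_lambda _ fun c => measurable_pi_apply _)
  have hφ' : Measurable fun z : S' → Y => G' fun c => z ⟨g' c, by simp [hS']⟩ :=
    hG'.comp (measurable_pi_lambda _ fun c => measurable_pi_apply _)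
  exact h2.comp hφ hφ'

/-- Chebyshev's inequality for the average of `T` pairwise independent variables in `[0,1]`. -/
lemma measureReal_abs_sum_sub_le {Ω : Type*} [MeasurableSpace Ω] (μ : Measure Ω)
    [IsProbabilityMeasure μ] {T : ℕ} (hT : 0 < T) (X : Fin T → Ω → ℝ)
    (hX : ∀ t, Measurable (X t)) (hX01 : ∀ t ω, X t ω ∈ Set.Icc (0 : ℝ) 1)
    (hind : Pairwise fun t t' => IndepFun (X t) (X t') μ) {a : ℝ} (ha : ∀ t, ∫ ω, X t ω ∂μ = a) :
    μ.real {ω | 5 / 12 * T ≤ |∑ t, X t ω - T * a|} ≤ 2 / T := by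
  have hT' : (0 : ℝ) < T := by exact_mod_cast hT
  have hbd : ∀ t, ∀ᵐ ω ∂μ, X t ω ∈ Set.Icc (0 : ℝ) 1 := fun t => ae_of_all _ (hX01 t)
  have hL : ∀ t, MemLp (X t) 2 μ := fun t =>
    memLp_of_bounded (hbd t) (hX t).aestronglyMeasurable 2
  have hint : ∫ ω, (∑ t, X t) ω ∂μ = T * a := by
    simp only [Finset.sum_apply]
    rw [integral_finsetSum _ fun t _ => (hL t).integrable (by norm_num)]
    simp [ha]
  have hvar : Var[∑ t, X t; μ] ≤ T / 4 := by
    rw [IndepFun.variance_sum (fun t _ => hL t) fun t _ t' _ htt' => hind htt']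
    refine (Finset.sum_le_sum fun t _ =>
      variance_le_sq_of_bounded (hbd t) (hX t).aemeasurable).trans (le_of_eq ?_)
    simp
    ring
  have h := meas_ge_le_variance_div_sq (memLp_finsetSum' Finset.univ fun t _ => hL t)
    (show 0 < 5 / 12 * (T : ℝ) by positivity) (μ := μ)
  rw [hint] at h
  simp only [Finset.sum_apply] at h
  refine (ENNReal.toReal_le_of_le_ofReal
    (div_nonneg (variance_nonneg _ _) (by positivity)) h).trans ?_
  -- `(T / 4) / (5 * T / 12)² = 36 / (25 * T)`, below `2 / T`.
  rw [div_le_div_iff₀ (by positivity) hT']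
  nlinarith

/-! ### The combined public-coin protocol. -/

section Combine

variable {Y : Type*} [MeasurableSpace Y] {𝒲 : (k : ℕ) → Set (Channel k Y)} {k m s n R T : ℕ}

/-- The users of the combined protocol: `T` copies of `n` users for each of `R` maps. -/
def userEquiv (R T n : ℕ) : Fin (R * T * n) ≃ (Fin R × Fin T) × Fin n :=
  (finProdFinEquiv.symm).trans (finProdFinEquiv.symm.prodCongr (Equiv.refl _))

/-- The indices of the users of copy `t` for the map `j`. -/
def userIndex (j : Fin R) (t : Fin T) (i : Fin n) : Fin (R * T * n) :=
  (userEquiv R T n).symm ((j, t), i)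

lemma userEquiv_userIndex (j : Fin R) (t : Fin T) (i : Fin n) :
    userEquiv R T n (userIndex j t i) = ((j, t), i) := by
  simp [userIndex]

lemma userIndex_injective (j : Fin R) (t : Fin T) :
    Function.Injective fun i : Fin n => userIndex j t i := fun i i' h => by
  simpa [userIndex] using h

/-- The messages for which the combined protocol rejects: for one of the maps, at least half of
the `T` copies reject on average. -/
def rejectSet (P : (Fin s → Bool) → Fin R → SMPProtocol (𝒲 m) 0 n) (T : ℕ) (u : Fin s → Bool) :
    Set (Fin (R * T * n) → Y) :=
  ⋃ j, {y | (T : ℝ) / 2 ≤ ∑ t, (P u j).rejectProb default fun i => y (userIndex j t i)}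

lemma measurable_block_rejectProb (P : (Fin s → Bool) → Fin R → SMPProtocol (𝒲 m) 0 n)
    (u : Fin s → Bool) (j : Fin R) (t : Fin T) :
    Measurable fun y : Fin (R * T * n) → Y =>
      (P u j).rejectProb default fun i => y (userIndex j t i) :=
  ((P u j).measurable_rejectProb default).comp
    (measurable_pi_lambda _ fun _ => measurable_pi_apply _)

lemma measurableSet_rejectSet (P : (Fin s → Bool) → Fin R → SMPProtocol (𝒲 m) 0 n) (T : ℕ)
    (u : Fin s → Bool) : MeasurableSet (rejectSet P T u) :=
  MeasurableSet.iUnion fun j => measurableSet_le measurable_const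
    (Finset.measurable_sum _ fun t _ => measurable_block_rejectProb P u j t)

open Classical in
lemma measurable_mem_rejectSet (P : (Fin s → Bool) → Fin R → SMPProtocol (𝒲 m) 0 n) (T : ℕ)
    (u : Fin s → Bool) :
    Measurable fun y : Fin (R * T * n) → Y => if y ∈ rejectSet P T u then true else false :=
  Measurable.ite (measurableSet_rejectSet P T u) measurable_const measurable_const

open Classical in
/-- The public-coin protocol that, given the coins `u`, compresses the domain by each of the maps
`f u j` and runs `T` copies of the private-coin protocol `P u j`. -/
noncomputable def combine (hmk : m ≤ k) (h𝒲 : ClosedUnderCompression 𝒲)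
    (f : (Fin s → Bool) → Fin R → Fin k → Fin m)
    (P : (Fin s → Bool) → Fin R → SMPProtocol (𝒲 m) 0 n) (T : ℕ) :
    SMPProtocol (𝒲 k) s (R * T * n) where
  -- The space of private randomness may not depend on the coins, whereas the private-coin protocol
  -- does. So a user draws a variable for every outcome `u` and uses only the one for the actual
  -- coins.
  Ω v := ∀ u, (P u (userEquiv R T n v).1.1).Ω (userEquiv R T n v).2
  measurableSpaceΩ _ := inferInstance
  μ v := Measure.pi fun u => (P u (userEquiv R T n v).1.1).μ (userEquiv R T n v).2
  isProbabilityMeasure _ := inferInstance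
  channel v u ω x := (P u (userEquiv R T n v).1.1).channel (userEquiv R T n v).2 default (ω u)
    (f u (userEquiv R T n v).1.1 x)
  channel_mem v u ω := h𝒲 m k hmk _ _ ((P u (userEquiv R T n v).1.1).channel_mem _ default (ω u))
  measurable_channel v u x := ((P u (userEquiv R T n v).1.1).measurable_channel
    (userEquiv R T n v).2 default (f u (userEquiv R T n v).1.1 x)).comp (measurable_pi_apply u)
  server u := Kernel.deterministic (fun y => if y ∈ rejectSet P T u then true else false)
    (measurable_mem_rejectSet P T u)
  isMarkovKernel_server _ := inferInstance

variable (hmk : m ≤ k) (h𝒲 : ClosedUnderCompression 𝒲)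
  (f : (Fin s → Bool) → Fin R → Fin k → Fin m)
  (P : (Fin s → Bool) → Fin R → SMPProtocol (𝒲 m) 0 n)

lemma combine_messageLaw (p : PMF (Fin k)) (u : Fin s → Bool) (v : Fin (R * T * n)) :
    (combine hmk h𝒲 f P T).messageLaw p u v =
      (P u (userEquiv R T n v).1.1).messageLaw (p.map (f u (userEquiv R T n v).1.1)) default
        (userEquiv R T n v).2 := by
  set j := (userEquiv R T n v).1.1
  set i := (userEquiv R T n v).2
  have h1 := measurePreserving_eval (fun u => (P u j).μ i) u
  have h2 : (P u j).messageLaw (p.map (f u j)) default i = ((Measure.pi fun u => (P u j).μ i).map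
      (Function.eval u)).bind fun ω => (p.map (f u j)).toMeasure.bind
        fun x => ((P u j).channel i default ω x : Measure Y) := by
    rw [h1.map_eq]
    rfl
  rw [h2, bind_map_eq_bind_comp _ h1.measurable ((P u j).measurable_messageLaw_aux _ _ _)]
  simp only [← PMF.toMeasure_map _ p (Measurable.of_discrete (f := f u j)),
    bind_map_eq_bind_comp _ (Measurable.of_discrete (f := f u j)) Measurable.of_discrete]
  rfl

open Classical in
lemma combine_outputLaw_real_true (p : PMF (Fin k)) (u : Fin s → Bool) :
    ((combine hmk h𝒲 f P T).outputLaw p u).real {true} =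
      (Measure.pi ((combine hmk h𝒲 f P T).messageLaw p u)).real (rejectSet P T u) := by
  have h : (combine hmk h𝒲 f P T).outputLaw p u =
      (Measure.pi ((combine hmk h𝒲 f P T).messageLaw p u)).map
        (fun y => if y ∈ rejectSet P T u then true else false) :=
    Measure.deterministic_comp_eq_map (measurable_mem_rejectSet P T u)
  rw [h, map_measureReal_apply (measurable_mem_rejectSet P T u) (measurableSet_singleton _)]
  congr 1
  ext y
  simp

/-- For each of the maps, the average of the rejection probabilities of the `T` copies is
concentrated around the rejection probability of the private-coin protocol. -/
lemma combine_concentration (hT : 0 < T) (p : PMF (Fin k)) (u : Fin s → Bool) (j : Fin R) :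
    (Measure.pi ((combine hmk h𝒲 f P T).messageLaw p u)).real
      {y | 5 / 12 * T ≤ |∑ t, (P u j).rejectProb default (fun i => y (userIndex j t i)) -
        T * (P u j).outputProb (p.map (f u j)) true|} ≤ 2 / T := by
  have hind : Pairwise fun t t' : Fin T => IndepFun
      (fun y => (P u j).rejectProb default fun i => y (userIndex j t i))
      (fun y => (P u j).rejectProb default fun i => y (userIndex j t' i))
      (Measure.pi ((combine hmk h𝒲 f P T).messageLaw p u)) := by
    intro t t' htt'
    refine indepFun_of_disjoint_blocks _ (fun i i' h => htt' ?_)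
      ((P u j).measurable_rejectProb default) ((P u j).measurable_rejectProb default)
    have := congrArg (userEquiv R T n) h
    simp only [userEquiv_userIndex, Prod.mk.injEq, true_and] at this
    exact this.1
  have hmean : ∀ t : Fin T, ∫ y, (P u j).rejectProb default (fun i => y (userIndex j t i))
      ∂(Measure.pi ((combine hmk h𝒲 f P T).messageLaw p u)) =
      (P u j).outputProb (p.map (f u j)) true := by
    intro t
    have hm : Measurable fun (y : Fin (R * T * n) → Y) i => y (userIndex j t i) :=
      measurable_pi_lambda _ fun _ => measurable_pi_apply _
    have h1 := integral_map hm.aemeasurable (μ := Measure.pi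
      ((combine hmk h𝒲 f P T).messageLaw p u))
      ((P u j).measurable_rejectProb default).aestronglyMeasurable
    have h2 : (fun i => (combine hmk h𝒲 f P T).messageLaw p u (userIndex j t i)) =
        (P u j).messageLaw (p.map (f u j)) default := by
      ext i : 1
      rw [combine_messageLaw, userEquiv_userIndex]
    rw [← h1, map_comp_injective_pi _ (userIndex_injective j t), h2,
      SMPProtocol.outputProb_zero_coins, ← SMPProtocol.integral_rejectProb]
  have hconc := measureReal_abs_sum_sub_le
    (Measure.pi ((combine hmk h𝒲 f P T).messageLaw p u)) hT
    (fun t (y : Fin (R * T * n) → Y) => (P u j).rejectProb default fun i => y (userIndex j t i))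
    (fun t => measurable_block_rejectProb P u j t)
    (fun t y => (P u j).rejectProb_mem_Icc default _)
    hind hmean
  exact hconc

/-- Rejection needs an average of `1/2` for some map, which is `5/12` above a mean of at most
`1/12`; union bound over the maps. -/
lemma combine_reject_le (hT : 0 < T) (p : PMF (Fin k)) (u : Fin s → Bool)
    (h : ∀ j, (P u j).outputProb (p.map (f u j)) true ≤ 1 / 12) :
    ((combine hmk h𝒲 f P T).outputLaw p u).real {true} ≤ R * (2 / T) := by
  rw [combine_outputLaw_real_true, rejectSet]
  refine (measureReal_iUnion_fintype_le _).trans ?_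
  refine (Finset.sum_le_sum fun j _ => (measureReal_mono ?_).trans
    (combine_concentration hmk h𝒲 f P hT p u j)).trans (by simp)
  intro y hy
  simp only [Set.mem_ofPred_eq] at hy ⊢
  refine le_trans ?_ (le_abs_self _)
  have hT' : (0 : ℝ) < T := by exact_mod_cast hT
  nlinarith [h j]

/-- One good map suffices: acceptance forces its average below `1/2`, more than `5/12` under its
mean. -/
lemma combine_le_reject (hT : 0 < T) (p : PMF (Fin k)) (u : Fin s → Bool)
    (h : ∃ j, 11 / 12 ≤ (P u j).outputProb (p.map (f u j)) true) :
    1 - 2 / T ≤ ((combine hmk h𝒲 f P T).outputLaw p u).real {true} := by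
  obtain ⟨j, hj⟩ := h
  rw [combine_outputLaw_real_true]
  have h1 := combine_concentration hmk h𝒲 f P hT p u j
  have h2 := probReal_compl_eq_one_sub (μ := Measure.pi ((combine hmk h𝒲 f P T).messageLaw p u))
    (measurableSet_rejectSet P T u)
  refine le_trans ?_ (le_of_eq (show 1 - (Measure.pi ((combine hmk h𝒲 f P T).messageLaw p u)).real
    (rejectSet P T u)ᶜ = _ by rw [h2]; ring))
  refine sub_le_sub_left ((measureReal_mono ?_).trans h1) 1
  intro y hy
  simp only [rejectSet, Set.mem_compl_iff, Set.mem_iUnion, Set.mem_ofPred_eq, not_exists,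
    not_le] at hy ⊢
  refine le_trans ?_ (neg_le_abs _)
  have hT' : (0 : ℝ) < T := by exact_mod_cast hT
  nlinarith [hy j]

-- When `p = q` every map sends `p` to the reference of its test, so acceptance is likely for all
-- coins. For far `p`, coins for which every map fails cost at most `η`.
open Classical in
lemma combine_testsIdentity (hT : 0 < T) (q : PMF (Fin k)) {ε ε' η δ : ℝ}
    (hP : ∀ u j, (P u j).TestsIdentity (q.map (f u j)) ε' (1 / 12))
    (hf : ∀ p : PMF (Fin k), ε < tvDist p q → ((Finset.univ.filter fun u => ∀ j,
      tvDist (p.map (f u j)) (q.map (f u j)) ≤ ε').card : ℝ) ≤ η * 2 ^ s)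
    (h1 : R * (2 / T : ℝ) < δ) (h2 : 2 / T + η < δ) :
    (combine hmk h𝒲 f P T).TestsIdentity q ε δ := by
  have hcard : ∑ u : Fin s → Bool, (1 : ℝ) = 2 ^ s := by simp
  refine ⟨?_, fun p hp => ?_⟩
  · rw [SMPProtocol.outputProb, lt_div_iff₀ (by positivity)]
    have h3 : ∀ u, 1 - R * (2 / T : ℝ) ≤ ((combine hmk h𝒲 f P T).outputLaw q u).real {false} := by
      intro u
      rw [SMPProtocol.outputLaw_real_false]
      refine sub_le_sub_left (combine_reject_le hmk h𝒲 f P hT q u fun j => ?_) 1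
      have := (hP u j).1
      rw [SMPProtocol.outputProb_zero_coins, SMPProtocol.outputLaw_real_false] at this
      rw [SMPProtocol.outputProb_zero_coins]
      linarith
    refine lt_of_lt_of_le ?_ (Finset.sum_le_sum fun u _ => h3 u)
    have h4 : ∑ u : Fin s → Bool, (1 - R * (2 / T : ℝ)) = (1 - R * (2 / T : ℝ)) * 2 ^ s := by
      rw [← hcard, Finset.mul_sum, mul_one]
    rw [h4]
    exact mul_lt_mul_of_pos_right (by linarith) (by positivity)
  · rw [SMPProtocol.outputProb, lt_div_iff₀ (by positivity)]
    have h3 : ∀ u, (1 - 2 / T : ℝ) - (if ∀ j, tvDist (p.map (f u j)) (q.map (f u j)) ≤ ε'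
        then 1 else 0) ≤ ((combine hmk h𝒲 f P T).outputLaw p u).real {true} := by
      intro u
      split_ifs with hu
      · have : (0 : ℝ) ≤ 2 / T := by positivity
        exact le_trans (by linarith) measureReal_nonneg
      · rw [sub_zero]
        push Not at hu
        obtain ⟨j, hj⟩ := hu
        have := (hP u j).2 _ hj
        exact combine_le_reject hmk h𝒲 f P hT p u ⟨j, by linarith⟩
    refine lt_of_lt_of_le ?_ (Finset.sum_le_sum fun u _ => h3 u)
    rw [Finset.sum_sub_distrib, Finset.sum_boole]
    have h4 : ∑ u : Fin s → Bool, (1 - 2 / T : ℝ) = (1 - 2 / T : ℝ) * 2 ^ s := by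
      rw [← hcard, Finset.mul_sum, mul_one]
    rw [h4]
    have h5 := hf p hp
    have h6 : (0 : ℝ) < 2 ^ s := by positivity
    nlinarith

end Combine

end DistributedTesting

/-! ### Choice of constants. -/

open DistributedTesting in
theorem mainTheorem6 :
    ∃ s₀ c₀ c c' : ℝ, 0 < s₀ ∧ 0 < c₀ ∧ 0 < c ∧ 0 < c' ∧
      ∀ δ : ℝ, 0 < δ → δ < 1 → ∃ C : ℕ, 0 < C ∧
        ∀ (Y : Type*) [MeasurableSpace Y] (𝒲 : (k : ℕ) → Set (DistributedTesting.Channel k Y)),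
          DistributedTesting.ClosedUnderCompression 𝒲 →
          ∀ (k s n : ℕ) (ε : ℝ), 0 < ε → ε < 1 →
            s₀ < (s : ℝ) → (s : ℝ) ≤ Real.logb 2 (k : ℝ) - c₀ →
            DistributedTesting.HasPrivateCoinTest (𝒲 ⌈c * (k : ℝ) / 2 ^ s⌉₊) n
              (c' * ε / (2 : ℝ) ^ ((s : ℝ) / 2)) (1 / 12) →
            DistributedTesting.HasSCoinTest (𝒲 k) s (C * n) ε δ := by
  -- `s > 3` gives `2^s ≥ 4`, hence `m ≤ k`. With `c = 4` and `k ≥ 2^s`, there is room for two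
  -- points per block: `2⌈k/2^s⌉ ≤ m`. The factor `1/32` is the loss in the compression.
  refine ⟨3, 1, 4, 1 / 32, by norm_num, by norm_num, by norm_num, by norm_num, fun δ hδ _ => ?_⟩
  -- Bad coins cost at most `4 / h < δ / 2`; with `T > 4 * R / δ` below, concentration failures cost
  -- at most `R * (2 / T) < δ / 2`.
  obtain ⟨h, hh⟩ := exists_nat_gt (8 / δ)
  have hh0 : (0 : ℝ) < h := lt_trans (by positivity) hh
  obtain ⟨R, hR, hcomp⟩ := exists_domain_compression h (by exact_mod_cast hh0)
  have hR1 : (1 : ℝ) ≤ R := by exact_mod_cast hR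
  obtain ⟨T, hT⟩ := exists_nat_gt (4 * R / δ)
  have hT0 : (0 : ℝ) < T := lt_trans (by positivity) hT
  have hT0' : 0 < T := by exact_mod_cast hT0
  refine ⟨R * T, Nat.mul_pos hR hT0', fun Y _ 𝒲 h𝒲 k s n ε hε _ hs hsk hpriv q => ?_⟩
  have hk0 : (0 : ℝ) < k := by
    rcases Nat.eq_zero_or_pos k with rfl | hk
    · simp only [Nat.cast_zero, Real.logb_zero] at hsk
      linarith
    · exact_mod_cast hk
  have h2s : (0 : ℝ) < 2 ^ s := by positivity
  have hks : (2 : ℝ) ^ s ≤ k := by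
    rw [← Real.rpow_natCast, ← Real.le_logb_iff_rpow_le (by norm_num) hk0]
    linarith
  have h4s : (4 : ℝ) ≤ 2 ^ s := by
    have : 2 ≤ s := by
      have : (2 : ℝ) ≤ s := by linarith
      exact_mod_cast this
    calc (4 : ℝ) = 2 ^ 2 := by norm_num
      _ ≤ 2 ^ s := pow_le_pow_right₀ (by norm_num) this
  set m := ⌈4 * (k : ℝ) / 2 ^ s⌉₊ with hm
  set B := ⌈(k : ℝ) / 2 ^ s⌉₊ with hB
  have hmk : m ≤ k := by
    rw [hm, Nat.ceil_le, div_le_iff₀ h2s]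
    nlinarith
  have hkB : k ≤ B * 2 ^ s := by
    have := Nat.le_ceil ((k : ℝ) / 2 ^ s)
    rw [← hB, div_le_iff₀ h2s] at this
    exact_mod_cast this
  have hBm : 2 * B ≤ m := by
    have h1 : (B : ℝ) < k / 2 ^ s + 1 := Nat.ceil_lt_add_one (by positivity)
    have h2 : 4 * (k : ℝ) / 2 ^ s ≤ m := Nat.le_ceil _
    have h3 : (1 : ℝ) ≤ k / 2 ^ s := by rwa [le_div_iff₀ h2s, one_mul]
    rw [mul_div_assoc] at h2
    have : (2 * B : ℝ) ≤ m := by linarith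
    exact_mod_cast this
  obtain ⟨f, hf⟩ := hcomp s k B m hkB hBm
  -- Each compressed problem has its own reference distribution, hence its own private-coin test.
  choose P hP using fun u j => hpriv (q.map (f u j))
  have hroot : (2 : ℝ) ^ ((s : ℝ) / 2) = √(2 ^ s) := by
    rw [Real.sqrt_eq_rpow, ← Real.rpow_natCast_mul (by norm_num)]
    congr 1
    ring
  refine ⟨combine hmk h𝒲 f P T, combine_testsIdentity hmk h𝒲 f P hT0' q (η := 4 / h) hP ?_ ?_ ?_⟩
  · intro p hp
    rw [div_mul_eq_mul_div (4 : ℝ), le_div_iff₀ hh0, mul_comm]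
    have h1 := hf p q
    refine le_trans ?_ (show ((h * _ : ℕ) : ℝ) ≤ 4 * 2 ^ s by exact_mod_cast h1)
    push_cast
    refine mul_le_mul_of_nonneg_left (Nat.cast_le.2 (Finset.card_le_card ?_)) hh0.le
    intro u hu
    simp only [Finset.mem_filter, Finset.mem_univ, true_and] at hu ⊢
    intro j
    refine (hu j).trans_lt ?_
    rw [hroot]
    have : (0 : ℝ) < √(2 ^ s) := Real.sqrt_pos.2 h2s
    gcongr
  · rw [div_lt_iff₀ hδ] at hT
    rw [← mul_div_assoc, div_lt_iff₀ hT0]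
    nlinarith
  · rw [div_lt_iff₀ hδ] at hT hh
    have h1 : 2 / (T : ℝ) ≤ δ / 2 := by
      rw [div_le_iff₀ hT0]
      nlinarith
    have h2 : 4 / (h : ℝ) < δ / 2 := by
      rw [div_lt_iff₀ hh0]
      linarith
    linarith
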